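/- Let $q$ be a prime power, let $\ell\ge 1$, and let $X=\mathbb F_{q^\ell}$. Let the cyclic group $C_1=\mathbb F_q^\times$ of order $q-1$ act on $X$ by multiplication, and let the cyclic group $C_2=\mathrm{Gal}(\mathbb F_{q^\ell}/\mathbb F_q)$ of order $\ell$, generated by the Frobenius endomorphism, act on $X$ as usual; these actions commute, so $C_1\times C_2$ acts on $X$. For a word $w=w_1\cdots w_\ell$ with letters in $[q]=\{1,\dots,q\}$, let $\mathrm{maj}(w)$ be the sum of all positions $i$, $1\le i<\ell$, with $w_i>w_{i+1}$, and let $\mathrm{inv}(w)$ be the number of pairs $i<j$ with $w_i>w_j$. Let $$f(x_1,\dots,x_q,t)=\sum_{w\in[q]^\ell}x_{w_1}\cdots x_{w_\ell}\,t^{\mathrm{maj}(w)},$$ and let $X(u,t)=f(1,u,u^2,\dots,u^{q-1},t)\in\mathbb Z[u,t]$. Then $(X,X(u,t),C_1\times C_2)$ exhibits the cyclic sieving phenomenon: there are embeddings of groups $\omega_1:C_1\hookrightarrow\mathbb C^\times$ and $\omega_2:C_2\hookrightarrow\mathbb C^\times$, and for every choice of such embeddings and all $c_1\in C_1$, $c_2\in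 C_2$, $$\bigl|\{x\in X:\ (c_1,c_2)\cdot x=x\}\bigr|=X\bigl(\omega_1(c_1),\omega_2(c_2)\bigr).$$ The same holds for the polynomial $X(u,t)$ obtained with $\mathrm{inv}(w)$ in place of $\mathrm{maj}(w)$ in the definition of $f$. -/

import Mathlib

/-- The inversion number of the word `w 0, w 1, …, w (ℓ - 1)`: the number of pairs of positions
`i < j` with `w i > w j`. -/
def Word.inv {n ℓ : ℕ} (w : Fin ℓ → Fin n) : ℕ :=
  (Finset.univ.filter fun p : Fin ℓ × Fin ℓ => p.1 < p.2 ∧ w p.2 < w p.1).card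

/-- The major index of a word: the sum of all positions `i`, `1 ≤ i < ℓ`, such that the `i`-th
letter is greater than the `(i + 1)`-st. Since `Fin ℓ` counts positions from `0`, the descent at
`i : Fin ℓ` is at position `i + 1`. -/
def Word.maj {n ℓ : ℕ} (w : Fin ℓ → Fin n) : ℕ :=
  ∑ i : Fin ℓ, if h : (i : ℕ) + 1 < ℓ then
    (if w ⟨(i : ℕ) + 1, h⟩ < w i then (i : ℕ) + 1 else 0) else 0

/-- For a statistic `stat` on words, the generating function
`∑_w x_{w_1} ⋯ x_{w_ℓ} t ^ stat w` over all words of length `ℓ` in an `n`-letter alphabet, a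
polynomial in `x_1, …, x_n` with coefficients in `ℤ[t]`. -/
noncomputable def wordGenFun (n ℓ : ℕ) (stat : (Fin ℓ → Fin n) → ℕ) :
    MvPolynomial (Fin n) (Polynomial ℤ) :=
  ∑ w : Fin ℓ → Fin n,
    (∏ j : Fin ℓ, MvPolynomial.X (w j)) * MvPolynomial.C (Polynomial.X ^ stat w)

/-- The principal `u`-specialization `f (1, u, u ^ 2, …, u ^ (n - 1))` of a polynomial with
coefficients in `ℤ[t]`, as an element of `ℤ[u, t]`. The variable `u` is `X 0` and the variable `t`
is `X 1`. -/
noncomputable def principalSpecialization {n : ℕ}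
    (f : MvPolynomial (Fin n) (Polynomial ℤ)) : MvPolynomial (Fin 2) ℤ :=
  MvPolynomial.eval₂
    (Polynomial.aeval (MvPolynomial.X 1 : MvPolynomial (Fin 2) ℤ)).toRingHom
    (fun i : Fin n => (MvPolynomial.X 0 : MvPolynomial (Fin 2) ℤ) ^ (i : ℕ)) f

/-- Let the finite set `X` carry commuting actions of the finite cyclic groups `C₁` and `C₂`, and
hence the action `(c₁, c₂) • x = c₁ • c₂ • x` of `C₁ × C₂`. The triple `(X, P(u, t), C₁ × C₂)`
exhibits the cyclic sieving phenomenon with respect to the embeddings `ω₁`, `ω₂` of the two groups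
into `ℂˣ` if the number of fixed points of every `(c₁, c₂)` is `P(ω₁ c₁, ω₂ c₂)`. -/
structure ExhibitsCSP (X : Type*) [Finite X] (P : MvPolynomial (Fin 2) ℤ)
    (C₁ C₂ : Type*) [Group C₁] [Finite C₁] [IsCyclic C₁] [Group C₂] [Finite C₂] [IsCyclic C₂]
    [MulAction C₁ X] [MulAction C₂ X] [SMulCommClass C₁ C₂ X]
    (ω₁ : C₁ →* ℂˣ) (ω₂ : C₂ →* ℂˣ) : Prop where
  injective_left : Function.Injective ω₁
  injective_right : Function.Injective ω₂
  card_fixedPoints : ∀ (c₁ : C₁) (c₂ : C₂),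
    ({x : X | c₁ • c₂ • x = x}.ncard : ℂ) =
      MvPolynomial.aeval ![(ω₁ c₁ : ℂ), (ω₂ c₂ : ℂ)] P

namespace Word

variable {n : ℕ} {R : Type*} [CommSemiring R]

theorem inv_snoc {ℓ : ℕ} (w : Fin ℓ → Fin n) (b : Fin n) :
    inv (Fin.snoc w b : Fin (ℓ + 1) → Fin n) =
      inv w + ∑ j, if b < w j then 1 else 0 := by
  simp only [inv, Finset.card_filter, Fintype.sum_prod_type, Fin.sum_univ_castSucc]
  simp [Fin.le_last, Finset.sum_add_distrib, not_lt.mpr]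

theorem maj_snoc {ℓ : ℕ} (w : Fin (ℓ + 1) → Fin n) (b : Fin n) :
    maj (Fin.snoc w b : Fin (ℓ + 2) → Fin n) =
      maj w + if b < w (Fin.last ℓ) then ℓ + 1 else 0 := by
  have key (i : Fin ℓ) : (⟨(i : ℕ) + 1, by lia⟩ : Fin (ℓ + 2)) = (i.succ).castSucc := rfl
  have key' (i : Fin ℓ) : (⟨(i : ℕ) + 1, by lia⟩ : Fin (ℓ + 1)) = i.succ := rfl
  have key2 : (⟨ℓ + 1, by lia⟩ : Fin (ℓ + 2)) = Fin.last (ℓ + 1) := rfl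
  simp only [maj, Fin.sum_univ_castSucc, Fin.val_castSucc, Fin.val_last]
  simp [key, key', key2, -Fin.castSucc_succ]

/-- The generating function of a statistic on words of length `ℓ`, evaluated at `x` and `t`. -/
def genSum {ℓ : ℕ} (stat : (Fin ℓ → Fin n) → ℕ) (x : Fin n → R) (t : R) : R :=
  ∑ w : Fin ℓ → Fin n, (∏ j, x (w j)) * t ^ stat w

/-- Multiply the variables of all letters greater than `b` by `t`. -/
def scaleAbove (t : R) (b : Fin n) (x : Fin n → R) : Fin n → R :=
  fun a => if b < a then t * x a else x a

theorem scaleAbove_comm (t : R) (a b : Fin n) (x : Fin n → R) :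
    scaleAbove t a (scaleAbove t b x) = scaleAbove t b (scaleAbove t a x) := by
  funext c
  simp only [scaleAbove]
  split_ifs <;> rfl

theorem sum_eq_sum_snoc {ℓ : ℕ} (F : (Fin (ℓ + 1) → Fin n) → R) :
    ∑ w, F w = ∑ b : Fin n, ∑ w : Fin ℓ → Fin n, F (Fin.snoc w b) := by
  rw [← (Fin.snocEquiv fun _ : Fin (ℓ + 1) => Fin n).sum_comp, Fintype.sum_prod_type]
  rfl

theorem genSum_inv_succ {ℓ : ℕ} (x : Fin n → R) (t : R) :
    genSum (inv (ℓ := ℓ + 1)) x t =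
      ∑ b, x b * genSum (inv (ℓ := ℓ)) (scaleAbove t b x) t := by
  rw [genSum, sum_eq_sum_snoc]
  refine Finset.sum_congr rfl fun b _ => ?_
  rw [genSum, Finset.mul_sum]
  refine Finset.sum_congr rfl fun w _ => ?_
  have h : ∏ j, scaleAbove t b x (w j) = t ^ (∑ j, if b < w j then 1 else 0) * ∏ j, x (w j) := by
    rw [← Finset.prod_pow_eq_pow_sum, ← Finset.prod_mul_distrib]
    refine Finset.prod_congr rfl fun j _ => ?_
    simp only [scaleAbove]
    split_ifs <;> simp
  rw [h, inv_snoc, Fin.prod_univ_castSucc]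
  simp only [Fin.snoc_castSucc, Fin.snoc_last, pow_add]
  ring

theorem genSum_zero (stat : (Fin 0 → Fin n) → ℕ) (h : ∀ w, stat w = 0) (x : Fin n → R) (t : R) :
    genSum stat x t = 1 := by
  simp [genSum, h]

theorem genSum_inv_scaleAbove {ℓ : ℕ} (x : Fin n → R) (t : R) (b : Fin n) :
    genSum (inv (ℓ := ℓ + 1)) (scaleAbove t b x) t =
      ∑ a, (if b < a then t ^ (ℓ + 1) else 1) *
        (x a * genSum (inv (ℓ := ℓ)) (scaleAbove t a x) t) := by
  induction ℓ generalizing x b with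
  | zero =>
    rw [genSum_inv_succ]
    refine Finset.sum_congr rfl fun a _ => ?_
    rw [genSum_zero _ (by simp [inv]), genSum_zero _ (by simp [inv]), scaleAbove]
    split_ifs <;> simp
  | succ ℓ ih =>
    rw [genSum_inv_succ]
    have hx (a : Fin n) := congrArg (genSum (inv (ℓ := ℓ + 1)) · t) (scaleAbove_comm t a b x)
    simp only [ih (scaleAbove t _ x) b] at hx
    simp_rw [hx, genSum_inv_succ (ℓ := ℓ), Finset.mul_sum, ← Fintype.sum_prod_type']
    let e : Fin n × Fin n → Fin n × Fin n :=
      fun p => if (b < p.1 ↔ b < p.2) then p else p.swap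
    have he : Function.Involutive e := by
      intro p
      by_cases h : (b < p.1 ↔ b < p.2)
      · simp [e, h]
      · have h' : ¬ (b < p.2 ↔ b < p.1) := fun k => h k.symm
        simp [e, h, h']
    refine Fintype.sum_equiv he.toPerm _ _ fun ⟨a, c⟩ => ?_
    by_cases ha : b < a <;> by_cases hc : b < c
    · simp [e, ha, hc, scaleAbove]; ring_nf
    · have hca : c < a := by order
      have hac : ¬ a < c := by order
      simp only [Function.Involutive.coe_toPerm, e, ha, hc, iff_false, not_true, if_false,
        Prod.swap_prod_mk]
      rw [scaleAbove_comm t a c]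
      simp [scaleAbove, ha, hac, hca]; ring
    · have hca : a < c := by order
      have hac : ¬ c < a := by order
      simp only [Function.Involutive.coe_toPerm, e, ha, hc, iff_true, if_false, if_true,
        Prod.swap_prod_mk]
      rw [scaleAbove_comm t a c]
      simp [scaleAbove, ha, hac, hca]; ring
    · simp [e, ha, hc, scaleAbove]

/-- The generating function of the major index over the words of length `ℓ + 1` with last
letter `b`. -/
def majLast (ℓ : ℕ) (x : Fin n → R) (t : R) (b : Fin n) : R :=
  ∑ w : Fin ℓ → Fin n, (∏ j, x (w j)) * x b * t ^ maj (Fin.snoc w b : Fin (ℓ + 1) → Fin n)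

theorem genSum_maj_succ {ℓ : ℕ} (x : Fin n → R) (t : R) :
    genSum (maj (ℓ := ℓ + 1)) x t = ∑ b, majLast ℓ x t b := by
  rw [genSum, sum_eq_sum_snoc]
  simp [majLast, Fin.prod_univ_castSucc]

theorem majLast_zero (x : Fin n → R) (t : R) (b : Fin n) : majLast 0 x t b = x b := by
  simp [majLast, maj]

theorem majLast_succ (ℓ : ℕ) (x : Fin n → R) (t : R) (b : Fin n) :
    majLast (ℓ + 1) x t b =
      x b * ∑ a, (if b < a then t ^ (ℓ + 1) else 1) * majLast ℓ x t a := by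
  rw [majLast, sum_eq_sum_snoc, Finset.mul_sum]
  refine Finset.sum_congr rfl fun a _ => ?_
  rw [majLast, Finset.mul_sum, Finset.mul_sum]
  refine Finset.sum_congr rfl fun w _ => ?_
  rw [maj_snoc, Fin.prod_univ_castSucc]
  simp only [Fin.snoc_castSucc, Fin.snoc_last, pow_add]
  split_ifs <;> ring

theorem majLast_eq (ℓ : ℕ) (x : Fin n → R) (t : R) (b : Fin n) :
    majLast ℓ x t b = x b * genSum (inv (ℓ := ℓ)) (scaleAbove t b x) t := by
  induction ℓ generalizing b with
  | zero => rw [majLast_zero, genSum_zero _ (by simp [inv]), mul_one]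
  | succ ℓ ih => rw [majLast_succ, genSum_inv_scaleAbove]; simp_rw [ih]

/-- **MacMahon's theorem**: `maj` and `inv` are equidistributed on the words of given content. -/
theorem genSum_maj_eq_genSum_inv {ℓ : ℕ} (x : Fin n → R) (t : R) :
    genSum (maj (ℓ := ℓ)) x t = genSum (inv (ℓ := ℓ)) x t := by
  cases ℓ with
  | zero => rw [genSum_zero _ (by simp [maj]), genSum_zero _ (by simp [inv])]
  | succ ℓ => rw [genSum_maj_succ, genSum_inv_succ]; simp_rw [majLast_eq]

theorem majLast_add {d : ℕ} (x : Fin n → R) (t : R) (ht : t ^ (d + 1) = 1) (k : ℕ) (b : Fin n) :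
    majLast (d + 1 + k) x t b = genSum (maj (ℓ := d + 1)) x t * majLast k x t b := by
  induction k generalizing b with
  | zero => simp [majLast_succ, majLast_zero, genSum_maj_succ, ht, mul_comm]
  | succ k ih =>
    rw [← add_assoc, majLast_succ, majLast_succ]
    simp_rw [ih, add_assoc (d + 1) k 1, pow_add t (d + 1), ht, one_mul, Finset.mul_sum]
    exact Finset.sum_congr rfl fun a _ => by ring

theorem genSum_maj_mul {d : ℕ} (x : Fin n → R) (t : R) (ht : t ^ (d + 1) = 1) (m : ℕ) :
    genSum (maj (ℓ := (d + 1) * m)) x t = genSum (maj (ℓ := d + 1)) x t ^ m := by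
  induction m with
  | zero => exact (genSum_zero (maj (ℓ := 0)) (by simp [maj]) x t).trans (pow_zero _).symm
  | succ m ih =>
    have h : ∀ k, genSum (maj (ℓ := d + 1 + k)) x t =
        genSum (maj (ℓ := d + 1)) x t * genSum (maj (ℓ := k)) x t := by
      rintro (_ | k)
      · rw [genSum_zero (maj (ℓ := 0)) (by simp [maj]), mul_one, add_zero]
      · rw [← add_assoc (d + 1) k 1, genSum_maj_succ (ℓ := d + 1 + k), genSum_maj_succ (ℓ := k),
          Finset.mul_sum]
        simp_rw [majLast_add x t ht]
    rw [pow_succ', ← ih, ← h, mul_add, mul_one, add_comm]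

@[to_additive]
theorem prod_rotate {d : ℕ} {M : Type*} [CommMonoid M] (f : Fin (d + 1) → M) :
    ∏ i, f (i + 1) = ∏ i, f i :=
  Equiv.prod_comp (Equiv.addRight 1) f

/-- The number of cyclic descents of a word. -/
def cdes {d : ℕ} (w : Fin (d + 1) → Fin n) : ℕ :=
  ∑ i, if w (i + 1) < w i then 1 else 0

theorem pow_maj {d : ℕ} (t : R) (ht : t ^ (d + 1) = 1) (w : Fin (d + 1) → Fin n) :
    t ^ maj w = ∏ i, if w (i + 1) < w i then t ^ ((i : ℕ) + 1) else 1 := by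
  rw [maj, ← Finset.prod_pow_eq_pow_sum, Fin.prod_univ_castSucc, Fin.prod_univ_castSucc]
  congr 1
  · refine Finset.prod_congr rfl fun i _ => ?_
    have key : (⟨(i : ℕ) + 1, by lia⟩ : Fin (d + 1)) = i.castSucc + 1 := by
      rw [Fin.coeSucc_eq_succ]; rfl
    simp [key]
  · simp [ht]

theorem pow_maj_rotate {d : ℕ} (t : R) (ht : t ^ (d + 1) = 1) (w : Fin (d + 1) → Fin n) :
    t ^ cdes w * t ^ maj (fun i => w (i + 1)) = t ^ maj w := by
  rw [pow_maj t ht w, pow_maj t ht, cdes, ← Finset.prod_pow_eq_pow_sum,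
    ← prod_rotate fun i => t ^ ite (w (i + 1) < w i) 1 0,
    ← prod_rotate fun i => if w (i + 1) < w i then t ^ ((i : ℕ) + 1) else 1,
    ← Finset.prod_mul_distrib]
  refine Finset.prod_congr rfl fun i _ => ?_
  split_ifs with h
  · rw [pow_one, pow_succ' t ((i + 1 : Fin (d + 1)) : ℕ)]
    congr 1
    rcases Fin.eq_castSucc_or_eq_last i with ⟨j, rfl⟩ | rfl
    · simp
    · simp [ht]
  · simp

theorem cdes_rotate {d : ℕ} (w : Fin (d + 1) → Fin n) : cdes (fun i => w (i + 1)) = cdes w :=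
  sum_rotate fun i => if w (i + 1) < w i then 1 else 0

theorem cdes_lt {d : ℕ} (w : Fin (d + 1) → Fin n) : cdes w < d + 1 := by
  obtain ⟨i, hi⟩ := Finite.exists_min w
  calc cdes w < ∑ _ : Fin (d + 1), 1 := by
        refine Finset.sum_lt_sum (fun j _ => by split_ifs <;> simp) ⟨i, Finset.mem_univ _, ?_⟩
        simp [hi (i + 1)]
    _ = d + 1 := by simp

theorem cdes_eq_zero_iff {d : ℕ} (w : Fin (d + 1) → Fin n) :
    cdes w = 0 ↔ ∃ a, w = fun _ => a := by
  refine ⟨fun h => ?_, ?_⟩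
  · have h' (i) : w i ≤ w (i + 1) := by
      simp only [cdes, Finset.sum_eq_zero_iff] at h
      simpa using h i
    have hs : ∑ i, ((w (i + 1) : ℕ)) = ∑ i, (w i : ℕ) :=
      sum_rotate fun i => (w i : ℕ)
    have he (i) : w (i + 1) = w i := by
      have := (Finset.sum_eq_sum_iff_of_le fun i _ => Fin.le_def.mp (h' i)).mp hs.symm i
        (Finset.mem_univ i)
      exact (Fin.ext this).symm
    refine ⟨w 0, funext fun i => ?_⟩
    induction i using Fin.induction with
    | zero => rfl
    | succ i ih => rw [← Fin.coeSucc_eq_succ, he, ih]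
  · rintro ⟨a, rfl⟩
    simp [cdes]

/-- At a primitive root of unity of order the length of the words, the generating function of
`maj` is a power sum. -/
theorem genSum_maj_of_isPrimitiveRoot {d : ℕ} {A : Type*} [CommRing A] [IsDomain A]
    (x : Fin n → A) {t : A} (ht : IsPrimitiveRoot t (d + 1)) :
    genSum (maj (ℓ := d + 1)) x t = ∑ a, x a ^ (d + 1) := by
  rw [genSum, ← Finset.sum_fiberwise_of_maps_to (s := Finset.univ) (t := Finset.range (d + 1))
    (g := cdes) (fun w _ => Finset.mem_range.mpr (cdes_lt w))]
  rw [Finset.sum_range_succ', Finset.sum_eq_zero, zero_add]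
  · have him : (Finset.univ.filter fun w : Fin (d + 1) → Fin n => cdes w = 0) =
        Finset.univ.image fun a _ => a := by
      ext w; simp [cdes_eq_zero_iff, eq_comm (a := w)]
    rw [him, Finset.sum_image fun a _ b _ h => congrFun h 0]
    refine Finset.sum_congr rfl fun a _ => ?_
    simp [maj]
  · intro c hc
    have hc' : t ^ (c + 1) ≠ 1 :=
      ht.pow_ne_one_of_pos_of_lt c.succ_ne_zero (by have := Finset.mem_range.mp hc; lia)
    set S := ∑ w : Fin (d + 1) → Fin n with cdes w = c + 1, (∏ j, x (w j)) * t ^ maj w with hS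
    have hrot : t ^ (c + 1) * S = S := by
      conv_rhs => rw [hS]
      rw [hS, Finset.mul_sum, Finset.sum_filter, Finset.sum_filter,
        ← ((Equiv.addRight (1 : Fin (d + 1))).symm.arrowCongr (Equiv.refl (Fin n))).sum_comp]
      refine Finset.sum_congr rfl fun w _ => ?_
      have hw : ((Equiv.addRight (1 : Fin (d + 1))).symm.arrowCongr (Equiv.refl (Fin n))) w =
        fun i => w (i + 1) := rfl
      rw [hw, cdes_rotate]
      split_ifs with h
      · rw [← pow_maj_rotate t ht.pow_eq_one w, h,
          ← prod_rotate fun i => x (w i)]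
        ring
      · rfl
    have : (t ^ (c + 1) - 1) * S = 0 := by rw [sub_mul, hrot, one_mul, sub_self]
    exact (mul_eq_zero.mp this).resolve_left (sub_ne_zero.mpr hc')

theorem genSum_maj_mul_of_isPrimitiveRoot {d m : ℕ} (hd : d ≠ 0) {A : Type*} [CommRing A]
    [IsDomain A] (x : Fin n → A) {t : A} (ht : IsPrimitiveRoot t d) :
    genSum (maj (ℓ := d * m)) x t = (∑ a, x a ^ d) ^ m := by
  obtain ⟨d, rfl⟩ := Nat.exists_eq_succ_of_ne_zero hd
  rw [← genSum_maj_of_isPrimitiveRoot x ht, genSum_maj_mul x t ht.pow_eq_one]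

theorem aeval_principalSpecialization {ℓ : ℕ} (stat : (Fin ℓ → Fin n) → ℕ) {A : Type*} [CommRing A]
    (u t : A) :
    MvPolynomial.aeval ![u, t] (principalSpecialization (wordGenFun n ℓ stat)) =
      genSum stat (fun i => u ^ (i : ℕ)) t := by
  simp [principalSpecialization, wordGenFun, genSum, map_sum, map_prod, MvPolynomial.eval₂_sum,
    MvPolynomial.eval₂_prod, MvPolynomial.eval₂_mul, MvPolynomial.eval₂_pow]

end Word

theorem IsCyclic.exists_injective_monoidHom_units_complex (G : Type*) [Group G] [Finite G]
    [IsCyclic G] : ∃ ω : G →* ℂˣ, Function.Injective ω := by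
  have : NeZero (Nat.card G) := ⟨Nat.card_pos.ne'⟩
  have h : Nat.card G = Nat.card (rootsOfUnity (Nat.card G) ℂ) :=
    (Complex.isPrimitiveRoot_exp _ Nat.card_pos.ne').card_rootsOfUnity.symm
  let e : G ≃* rootsOfUnity (Nat.card G) ℂ := mulEquivOfCyclicCardEq h
  exact ⟨(rootsOfUnity (Nat.card G) ℂ).subtype.comp e.toMonoidHom,
    Subtype.val_injective.comp e.injective⟩

section FixedPoints

variable {K L : Type*} [Field K] [Field L] [Algebra K L]

theorem pow_smul_pow_smul_eq {c : Kˣ} {σ : Gal(L/K)} {x : L} (hx : c • σ • x = x) (k : ℕ) :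
    c ^ k • (σ ^ k) • x = x := by
  induction k with
  | zero => simp
  | succ k ih =>
    rw [pow_succ, pow_succ, mul_smul, mul_smul, smul_comm c (σ ^ k) (σ • x), hx, ih]

theorem exists_ne_zero_smul_eq [Finite L] (c : Kˣ) (σ : Gal(L/K)) (hc : c ^ orderOf σ = 1) :
    ∃ x : L, x ≠ 0 ∧ c • σ • x = x := by
  have hd : 0 < orderOf σ := orderOf_pos σ
  have hind := linearIndependent_monoidHom L L
  let f : Fin (orderOf σ) → (L →* L) := fun i => ((σ ^ (i : ℕ) : Gal(L/K)) : L →* L)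
  have hf : Function.Injective f := by
    intro i j hij
    have h : σ ^ (i : ℕ) = σ ^ (j : ℕ) := by
      ext y; exact DFunLike.congr_fun hij y
    exact Fin.ext (pow_injOn_Iio_orderOf i.2 j.2 h)
  have hli := Fintype.linearIndependent_iff.mp (hind.comp f hf)
  let S : L → L := fun y => ∑ i ∈ Finset.range (orderOf σ), c ^ i • (σ ^ i) • y
  have hex : ∃ y, S y ≠ 0 := by
    by_contra! h
    have := hli (fun i => algebraMap K L ((c ^ (i : ℕ) : Kˣ) : K)) (by
      funext y
      rw [Finset.sum_apply, Pi.zero_apply, ← h y]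
      simp only [S]
      rw [Finset.sum_range]
      refine Finset.sum_congr rfl fun i _ => ?_
      exact (Algebra.smul_def ((c ^ (i : ℕ) : Kˣ) : K) ((σ ^ (i : ℕ)) • y)).symm) ⟨0, hd⟩
    simp at this
  obtain ⟨y, hy⟩ := hex
  refine ⟨S y, hy, ?_⟩
  simp only [S]
  have hstep (i : ℕ) : c • σ • (c ^ i • (σ ^ i) • y) = c ^ (i + 1) • (σ ^ (i + 1)) • y := by
    rw [smul_comm σ (c ^ i), pow_succ', pow_succ', mul_smul, mul_smul]
  rw [Finset.smul_sum, Finset.smul_sum]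
  simp_rw [hstep]
  obtain ⟨d, hd'⟩ := Nat.exists_eq_succ_of_ne_zero hd.ne'
  have hσ := pow_orderOf_eq_one σ
  rw [hd'] at hc hσ ⊢
  rw [Finset.sum_range_succ, Finset.sum_range_succ' (fun i => c ^ i • (σ ^ i) • y)]
  rw [hc, hσ, pow_zero, pow_zero]

theorem ncard_fixedPoints_of_pow_eq_one [Finite L] {q m : ℕ} (c : Kˣ) (σ : Gal(L/K))
    (hq : Nat.card L = q ^ (orderOf σ * m)) (hc : c ^ orderOf σ = 1) :
    {x : L | c • σ • x = x}.ncard = q ^ m := by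
  obtain ⟨x₀, h0, hx₀⟩ := exists_ne_zero_smul_eq c σ hc
  let M := IntermediateField.fixedField (Subgroup.zpowers σ)
  have hset : {x : L | c • σ • x = x} = (fun y => y * x₀) '' (M : Set L) := by
    have hmem (y : L) : y ∈ M ↔ σ y = y := by
      rw [IntermediateField.mem_fixedField_iff]
      refine ⟨fun h => h σ (Subgroup.mem_zpowers σ), fun h τ hτ => ?_⟩
      have hs : σ ∈ MulAction.stabilizer Gal(L/K) y := h
      exact (Subgroup.zpowers_le.mpr hs) hτ
    ext x
    simp only [Set.mem_ofPred_eq, Set.mem_image, SetLike.mem_coe]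
    simp only [Units.smul_def, Algebra.smul_def, AlgEquiv.smul_def] at hx₀ ⊢
    have hσ0 : σ x₀ ≠ 0 := by simpa using h0
    constructor
    · intro hx
      refine ⟨x / x₀, (hmem _).mpr ?_, div_mul_cancel₀ x h0⟩
      rw [map_div₀, div_eq_div_iff hσ0 h0]
      nth_rewrite 2 [← hx]
      nth_rewrite 1 [← hx₀]
      ring
    · rintro ⟨y, hy, rfl⟩
      rw [map_mul, (hmem y).mp hy, mul_left_comm, hx₀]
  rw [hset, Set.ncard_image_of_injective _ (mul_left_injective₀ h0)]
  have hfin : Module.finrank M L = orderOf σ := by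
    rw [IntermediateField.finrank_fixedField_eq_card, Nat.card_zpowers]
  have hcard : Nat.card L = Nat.card M ^ orderOf σ := by
    rw [← hfin]; exact Module.natCard_eq_pow_finrank
  rw [hq, mul_comm, pow_mul] at hcard
  exact (Nat.pow_left_injective (orderOf_pos σ).ne' hcard).symm

theorem ncard_fixedPoints_of_pow_ne_one (c : Kˣ) (σ : Gal(L/K))
    (hc : c ^ orderOf σ ≠ 1) : {x : L | c • σ • x = x}.ncard = 1 := by
  rw [Set.ncard_eq_one]
  refine ⟨0, Set.eq_singleton_iff_unique_mem.mpr ⟨by simp, fun x hx => ?_⟩⟩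
  by_contra h0
  have h := pow_smul_pow_smul_eq hx (orderOf σ)
  rw [pow_orderOf_eq_one, one_smul, Units.smul_def, Algebra.smul_def] at h
  have h1 := (mul_eq_right₀ h0).mp h
  exact hc (Units.ext ((algebraMap K L).injective (by rw [h1, Units.val_one, map_one])))

end FixedPoints

theorem sum_range_pow_of_pow_pred_eq_one {A : Type*} [CommRing A] [IsDomain A] {q : ℕ}
    (hq : q ≠ 0) {v : A} (hv : v ^ (q - 1) = 1) (hv1 : v ≠ 1) :
    ∑ i ∈ Finset.range q, v ^ i = 1 := by
  obtain ⟨q, rfl⟩ := Nat.exists_eq_succ_of_ne_zero hq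
  rw [Nat.succ_sub_one] at hv
  have h : (∑ i ∈ Finset.range q, v ^ i) * (v - 1) = 0 := by rw [geom_sum_mul, hv, sub_self]
  rw [Finset.sum_range_succ, (mul_eq_zero.mp h).resolve_right (sub_ne_zero.mpr hv1), hv, zero_add]

theorem ncard_fixedPoints_eq_aeval {q ℓ : ℕ} {K L : Type*} [Field K] [Finite K] [Field L]
    [Finite L] [Algebra K L] (hK : Nat.card K = q) (hL : Nat.card L = q ^ ℓ)
    {ω₁ : Kˣ →* ℂˣ} {ω₂ : Gal(L/K) →* ℂˣ}
    (h₁ : Function.Injective ω₁) (h₂ : Function.Injective ω₂) (c : Kˣ) (σ : Gal(L/K)) :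
    ({x : L | c • σ • x = x}.ncard : ℂ) = MvPolynomial.aeval ![(ω₁ c : ℂ), (ω₂ σ : ℂ)]
      (principalSpecialization (wordGenFun q ℓ Word.maj)) := by
  have hq1 : 1 < q := hK ▸ Finite.one_lt_card
  have hℓ : Nat.card Gal(L/K) = ℓ := by
    rw [IsGalois.card_aut_eq_finrank]
    have h : Nat.card L = Nat.card K ^ Module.finrank K L := Module.natCard_eq_pow_finrank
    rw [hL, hK] at h
    exact (Nat.pow_right_injective hq1 h).symm
  obtain ⟨m, rfl⟩ : orderOf σ ∣ ℓ := hℓ ▸ orderOf_dvd_natCard σ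
  have hζ : IsPrimitiveRoot (ω₂ σ : ℂ) (orderOf σ) := by
    rw [← orderOf_injective ω₂ h₂ σ, ← orderOf_units]
    exact IsPrimitiveRoot.orderOf _
  rw [Word.aeval_principalSpecialization,
    Word.genSum_maj_mul_of_isPrimitiveRoot (orderOf_pos σ).ne' _ hζ]
  simp_rw [← pow_mul, mul_comm _ (orderOf σ), pow_mul]
  rw [Fin.sum_univ_eq_sum_range fun i => ((ω₁ c : ℂ) ^ orderOf σ) ^ i]
  have hpow (k : ℕ) : (ω₁ c : ℂ) ^ k = 1 ↔ c ^ k = 1 := by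
    rw [← map_eq_one_iff ω₁ h₁, map_pow, Units.ext_iff, Units.val_pow_eq_pow_val, Units.val_one]
  by_cases hc : c ^ orderOf σ = 1
  · rw [ncard_fixedPoints_of_pow_eq_one c σ hL hc, (hpow _).mpr hc]
    simp
  · rw [ncard_fixedPoints_of_pow_ne_one c σ hc, sum_range_pow_of_pow_pred_eq_one (by lia)]
    · simp
    · have hcard : c ^ (q - 1) = 1 := by
        rw [← hK, ← Nat.card_units]; exact pow_card_eq_one'
      rw [← pow_mul, mul_comm, pow_mul, (hpow _).mpr hcard, one_pow]
    · exact fun h => hc ((hpow _).mp h)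

theorem theorem1p2 (q ℓ : ℕ) (K L : Type*) [Field K] [Finite K] [Field L] [Finite L] [Algebra K L]
    (hK : Nat.card K = q) (hL : Nat.card L = q ^ ℓ) :
    (∃ ω₁ : Kˣ →* ℂˣ, Function.Injective ω₁) ∧
    (∃ ω₂ : Gal(L/K) →* ℂˣ, Function.Injective ω₂) ∧
    ∀ (ω₁ : Kˣ →* ℂˣ) (ω₂ : Gal(L/K) →* ℂˣ),
      Function.Injective ω₁ → Function.Injective ω₂ →
        ExhibitsCSP L (principalSpecialization (wordGenFun q ℓ Word.maj)) Kˣ Gal(L/K) ω₁ ω₂ ∧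
        ExhibitsCSP L (principalSpecialization (wordGenFun q ℓ Word.inv)) Kˣ Gal(L/K) ω₁ ω₂ := by
  refine ⟨IsCyclic.exists_injective_monoidHom_units_complex _,
    IsCyclic.exists_injective_monoidHom_units_complex _, fun ω₁ ω₂ h₁ h₂ =>
    ⟨⟨h₁, h₂, ncard_fixedPoints_eq_aeval hK hL h₁ h₂⟩, ⟨h₁, h₂, fun c σ => ?_⟩⟩⟩
  rw [ncard_fixedPoints_eq_aeval hK hL h₁ h₂, Word.aeval_principalSpecialization,
    Word.aeval_principalSpecialization, Word.genSum_maj_eq_genSum_inv]
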